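/- Let $\mathbb K$ be a field of characteristic zero and let $\mathbf{Sym}=\mathbb K\langle S_1,S_2,\dots\rangle$ be the algebra of noncommutative symmetric functions, i.e. the free associative algebra on the $S_n$ ($n\ge 1$), with $S_0=1$. Define the power sums $\Psi_n$ $(n\ge1)$ by $nS_n=\sum_{k=1}^{n}S_{n-k}\Psi_k$. For a composition $I=(i_1,\dots,i_r)$ with $r\ge 1$, Tevlin's noncommutative monomial symmetric function $\Psi_I$ is defined by $$ r\,\Psi_I=(-1)^{r-1}\,|A|_{r1}, $$ where $|A|_{r1}$ is the quasideterminant, with respect to the entry $(r,1)$, of the $r\times r$ matrix $A$ with entries $A_{kj}=\Psi_{i_{r-k+1}+\cdots+i_{r-j+1}}$ for $j\le k$, $A_{k,k+1}=k$, and $A_{kj}=0$ for $j>k+1$; here $|A|_{pq}=a_{pq}-\sum_{j\ne q,\,i\ne p}a_{pj}\,\bigl((A^{pq})^{-1}\bigr)_{ji}\,a_{iq}$, where $A^{pq}$ is $A$ with row $p$ and column $q$ deleted. For the empty composition, $\Psi_\emptyset=1$. Let $R_I=\sum_{J}(-1)^{\ell(I)-\ell(J)}S^J$ be the ribbon Schur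 functions, where $J$ runs over the compositions that are coarser than or equal to $I$, $\ell$ is the number of parts, and $S^J=S_{j_1}S_{j_2}\cdots S_{j_s}$ for $J=(j_1,\dots,j_s)$. A word $u=u_1\cdots u_n$ over the positive integers is packed if its set of letters is $\{1,\dots,m\}$ for some $m\ge 0$. The descent set of a composition $(i_1,\dots,i_r)$ is its set of partial sums. The descent composition $\operatorname{D}(u)$ is the composition of $n$ whose partial sums are $n$ together with the positions $p<n$ with $u_p>u_{p+1}$, and the W-composition $\operatorname{WC}(u)$ is the composition of $n$ whose descent set is the set of positions of the last occurrences of the letters of $u$. Theorem. Let $I$ be a composition of $n$. Then $$ R_I=\sum_{J\vDash n}K_{IJ}\,\Psi_J, $$ where $K_{IJ}$ is the number of packed words $u$ of length $n$ with $\operatorname{D}(u)=I$ and $\operatorname{WC}(u)=J$. Moreover, these are the only coefficients in $\mathbb K$ expressing $R_I$ as a linear combination of the $\Psi_J$, $J\vDash n$; in particular, the entries of the transition matrix from the ribbons to the $\Psi_J$ are nonnegative integers. -/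

import Mathlib

open Finset

noncomputable section

namespace NCSF

/-- The algebra **Sym** of noncommutative symmetric functions over `K`: the free associative
algebra on indeterminates `S₁, S₂, …`. -/
abbrev Sym (K : Type*) [Field K] : Type _ := FreeAlgebra K ℕ+

/-- The complete function `S n`: the `n`-th free generator for `n ≥ 1`, with `S₀ = 1`. -/
def S (K : Type*) [Field K] (n : ℕ) : Sym K :=
  if h : 0 < n then FreeAlgebra.ι K (⟨n, h⟩ : ℕ+) else 1

/-- The noncommutative power sums of the first kind, defined by the oriented Newton recursion
`n Sₙ = Sₙ₋₁ Ψ₁ + Sₙ₋₂ Ψ₂ + ⋯ + S₀ Ψₙ` for `n ≥ 1`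
(the value at `0` is a convention that is never used). -/
def powerSum (K : Type*) [Field K] : ℕ → Sym K
  | 0 => 0
  | n + 1 => (n + 1) • S K (n + 1) - ∑ k : Fin n, S K (n - k) * powerSum K (k + 1)

/-- The quasideterminant `|A|_{pq} = a_{pq} - ∑ a_{pj} (A^{pq})⁻¹_{ji} a_{iq}`, where `A^{pq}` is
`A` with row `p` and column `q` deleted (meaningful when `A^{pq}` is invertible). -/
def quasidet {R : Type*} [Ring R] {m : ℕ} (A : Matrix (Fin (m + 1)) (Fin (m + 1)) R)
    (p q : Fin (m + 1)) : R :=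
  A p q - ∑ j : Fin m, ∑ i : Fin m,
    A p (q.succAbove j) * Ring.inverse (A.submatrix p.succAbove q.succAbove) j i *
      A (p.succAbove i) q

/-- The `r × r` matrix attached to the parts `i₁, …, i_r`. In one-based indexing its `(k, j)` entry
is `Ψ` of `i_{r-k+1} + ⋯ + i_{r-j+1}` if `j ≤ k`, the scalar `k` if `j = k + 1`, and `0` if
`j > k + 1`. -/
def monomialMatrix (K : Type*) [Field K] {r : ℕ} (i : Fin r → ℕ) :
    Matrix (Fin r) (Fin r) (Sym K) :=
  Matrix.of fun k j =>
    if j ≤ k then powerSum K (∑ p ∈ Finset.Icc k.rev j.rev, i p)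
    else if (j : ℕ) = k + 1 then ((k + 1 : ℕ) : Sym K)
    else 0

/-- `Ψ_{(i₁, …, i_r)}`, given by `r Ψ = (-1)^{r-1} |A|_{r1}`, and `1` for the empty sequence. -/
def monomialOfParts (K : Type*) [Field K] : {r : ℕ} → (Fin r → ℕ) → Sym K
  | 0, _ => 1
  | m + 1, i =>
      ((m + 1 : ℕ) : K)⁻¹ • ((-1) ^ m * quasidet (monomialMatrix K i) (Fin.last m) 0)

/-- The noncommutative monomial symmetric function `Ψ_I`. -/
def Psi (K : Type*) [Field K] {n : ℕ} (I : Composition n) : Sym K :=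
  monomialOfParts K I.blocksFun

/-- The product `S^J = S_{j₁} ⋯ S_{j_s}`. -/
def Sprod (K : Type*) [Field K] {n : ℕ} (J : Composition n) : Sym K :=
  (J.blocks.map (S K)).prod

/-- The ribbon Schur function `R_I = ∑ (-1)^{ℓ(I) - ℓ(J)} S^J`, over the compositions `J` that are
coarser than or equal to `I`. -/
def ribbon (K : Type*) [Field K] {n : ℕ} (I : Composition n) : Sym K :=
  ∑ J : Composition n with J.boundaries ⊆ I.boundaries,
    (-1) ^ (I.length - J.length) * Sprod K J

/-- The composition of `n` whose partial sums are `0`, `n` and the elements of `s`. -/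
def compositionOfCuts {n : ℕ} (s : Finset (Fin (n + 1))) : Composition n :=
  CompositionAsSet.toComposition
    { boundaries := insert 0 (insert (Fin.last n) s)
      zero_mem := by simp
      getLast_mem := by simp }

/-- Packing: the `i`-th smallest letter occurring in `w` is replaced by `i`. -/
def pack {n : ℕ} (w : Fin n → ℕ) : Fin n → ℕ :=
  fun i => #{b ∈ Finset.univ.image w | b ≤ w i}

/-- A word is packed if it is equal to its packed word. -/
def IsPacked {n : ℕ} (u : Fin n → ℕ) : Prop := pack u = u

open Classical in
/-- The descent composition `D(u)`: with positions numbered from `1`, there is a cut at `p`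
(`1 ≤ p ≤ n - 1`) when `u_p > u_{p+1}`. -/
def descentComp {n : ℕ} (u : Fin n → ℕ) : Composition n :=
  compositionOfCuts
    {p : Fin (n + 1) | ∃ i j : Fin n, i.succ = p ∧ j.castSucc = p ∧ u j < u i}

open Classical in
/-- The W-composition `WC(u)`: with positions numbered from `1`, there is a cut at `p` when `p` is
the position of the last occurrence of some letter of `u`. -/
def wordComp {n : ℕ} (u : Fin n → ℕ) : Composition n :=
  compositionOfCuts
    {p : Fin (n + 1) | ∃ i : Fin n, i.succ = p ∧ ∀ j : Fin n, i < j → u j ≠ u i}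

/-- `K_{IJ}`: the number of packed words `u` with `D(u) = I` and `WC(u) = J`. -/
def packedCount {n : ℕ} (I J : Composition n) : ℕ :=
  {u : Fin n → ℕ | IsPacked u ∧ descentComp u = I ∧ wordComp u = J}.ncard

/-- The letters of a packed word of length `n` are at most `n`, so `packedCount` counts a finite
set. -/
theorem finite_packedWords (n : ℕ) : {u : Fin n → ℕ | IsPacked u}.Finite := by
  refine (Set.Finite.pi' (t := fun _ : Fin n => Set.Iic n) fun _ => Set.finite_Iic n).subset ?_
  intro u hu i
  have h : pack u i = u i := congrFun hu i
  rw [Set.mem_Iic, ← h]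
  calc pack u i ≤ (Finset.univ.image u).card := Finset.card_filter_le _ _
    _ ≤ (Finset.univ : Finset (Fin n)).card := Finset.card_image_le
    _ = n := by simp

end NCSF

end

/-! Write `ℓ` for the number of parts of `L`. Solving the triangular system behind the
quasideterminant turns Tevlin's definition into `Ψᵢ Ψ_L = (ℓ+1) Ψ_{i·L} + ℓ Ψ_{i▷L}` (concatenate,
or add `i` to the first part). With Newton's recursion this expands `S_{m+1} Ψ_L` with binomial
coefficients (`completeMulExpansion`).

Packed words obey the same rule. Every packed word of length `n + 1` arises once from one of length
`n`, by prepending a new letter (`ℓ+1` ways, creating a part of the W-composition) or a letter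
already present (`ℓ` ways, lengthening its first part). Prepending a weakly increasing run of `m +
1` letters and summing over the choices gives, by the hockey-stick identity, the same binomials.
Hence `S^J` is the sum of `Ψ_{WC(u)}` over packed `u` whose descents are cuts of `J`
(`descentSum_bits`, `Sprod_eq_sum_Psi`).

Möbius inversion on the Boolean lattice of cut sets isolates `D(u) = I` and gives the ribbon
formula. For uniqueness, the `Ψ_J` span all the `S^J`, which are independent and equally numerous.
-/

noncomputable section

namespace NCSF

/-! ### Compositions as lists of parts and as lists of bits. -/

/-- Adds `i` to the first part of a list, leaving the empty list unchanged. -/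
def addHead (i : ℕ) : List ℕ → List ℕ
  | [] => []
  | j :: L => (i + j) :: L

@[simp] lemma addHead_nil (i : ℕ) : addHead i [] = [] := rfl

@[simp] lemma addHead_cons (i j : ℕ) (L : List ℕ) : addHead i (j :: L) = (i + j) :: L := rfl

@[simp] lemma length_addHead (i : ℕ) (L : List ℕ) : (addHead i L).length = L.length := by
  cases L <;> rfl

@[simp] lemma addHead_zero (L : List ℕ) : addHead 0 L = L := by cases L <;> simp

lemma addHead_addHead (i j : ℕ) (L : List ℕ) : addHead i (addHead j L) = addHead (i + j) L := by
  cases L <;> simp [add_assoc]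

/-- The parts of the composition encoded by a list of Booleans, where `true` marks the last cell of
a part; trailing `false` entries are ignored. -/
def parts : List Bool → List ℕ
  | [] => []
  | true :: β => 1 :: parts β
  | false :: β => addHead 1 (parts β)

@[simp] lemma parts_nil : parts [] = [] := rfl

@[simp] lemma parts_true (β : List Bool) : parts (true :: β) = 1 :: parts β := rfl

@[simp] lemma parts_false (β : List Bool) : parts (false :: β) = addHead 1 (parts β) := rfl

lemma parts_replicate (k : ℕ) (β : List Bool) :
    parts (List.replicate k false ++ β) = addHead k (parts β) := by
  induction k with
  | zero => simp
  | succ k ih => simp [List.replicate_succ, ih, addHead_addHead, add_comm]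

/-! ### Products of complete functions with monomial functions. -/

section Algebra

variable (K : Type*) [Field K]

/-- Noncommutative monomial functions indexed by lists of parts, defined by the two-term recursion
coming from `Ψᵢ Ψ_L = (ℓ + 1) Ψ_{i·L} + ℓ Ψ_{i▷L}`. -/
def monomialOfList : List ℕ → Sym K
  | [] => 1
  | [i] => powerSum K i
  | i :: j :: L => ((L.length + 2 : ℕ) : K)⁻¹ •
      (powerSum K i * monomialOfList (j :: L) - (L.length + 1) • monomialOfList ((i + j) :: L))
  termination_by L => L.length

lemma powerSum_mul_monomialOfList [CharZero K] (i : ℕ) (L : List ℕ) :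
    powerSum K i * monomialOfList K L =
      (L.length + 1) • monomialOfList K (i :: L) + L.length • monomialOfList K (addHead i L) := by
  cases L with
  | nil => simp [monomialOfList]
  | cons j L =>
    have h : ((L.length + 2 : ℕ) : K) ≠ 0 := Nat.cast_ne_zero.2 (Nat.succ_ne_zero _)
    rw [monomialOfList]
    simp only [List.length_cons, addHead_cons]
    rw [show L.length + 1 + 1 = L.length + 2 from rfl, ← Nat.cast_smul_eq_nsmul K (L.length + 2),
      smul_smul, mul_inv_cancel₀ h, one_smul, sub_add_cancel]

/-- The monomial function of the composition encoded by a list of Booleans. -/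
def monomialOfBits (β : List Bool) : Sym K := monomialOfList K (parts β)

lemma powerSum_mul_monomialOfBits [CharZero K] (k : ℕ) (β : List Bool) :
    powerSum K (k + 1) * monomialOfBits K β =
      ((parts β).length + 1) • monomialOfBits K (List.replicate k false ++ true :: β) +
        (parts β).length • monomialOfBits K (List.replicate k false ++ false :: β) := by
  simp only [monomialOfBits, powerSum_mul_monomialOfList, parts_replicate, parts_true, parts_false,
    addHead_cons, addHead_addHead]

/-- The sum of the monomial functions over all extensions of `β` by `j` bits on the left. -/
def extensionSum : ℕ → List Bool → Sym K
  | 0, β => monomialOfBits K β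
  | j + 1, β => extensionSum j (true :: β) + extensionSum j (false :: β)

lemma extensionSum_succ (j : ℕ) (β : List Bool) :
    extensionSum K (j + 1) β = extensionSum K j (true :: β) + extensionSum K j (false :: β) := rfl

@[simp] lemma S_zero : S K 0 = 1 := by simp [S]

lemma newton (n : ℕ) :
    (n + 1) • S K (n + 1) = ∑ k ∈ range (n + 1), S K (n - k) * powerSum K (k + 1) := by
  rw [sum_range_succ, ← Fin.sum_univ_eq_sum_range (fun k => S K (n - k) * powerSum K (k + 1)) n]
  conv_rhs => rw [powerSum]
  simp

/-- The expansion of `S_{m+1} Ψ_β`. -/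
def CompleteMulExpansion (m : ℕ) : Prop :=
  ∀ β : List Bool, S K (m + 1) * monomialOfBits K β =
    ((parts β).length + m + 1).choose (m + 1) • extensionSum K m (true :: β) +
      ((parts β).length + m).choose (m + 1) • extensionSum K m (false :: β)

/-- Pascal's rule: the term `k = 0` is expanded by `H`, and the remaining terms form the same sum,
one step shorter, for `false :: γ`, which has as many parts as `γ`. -/
lemma sum_S_mul_monomialOfBits (m : ℕ) (H : ∀ j < m, CompleteMulExpansion K j) (γ : List Bool) :
    ∑ k ∈ range (m + 1), S K (m - k) * monomialOfBits K (List.replicate k false ++ γ) =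
      ((parts γ).length + m).choose m • extensionSum K m γ := by
  induction m generalizing γ with
  | zero => simp [extensionSum]
  | succ m ih =>
    rw [sum_range_succ']
    have h1 : ∀ k ∈ range (m + 1), S K (m + 1 - (k + 1)) *
        monomialOfBits K (List.replicate (k + 1) false ++ γ) =
        S K (m - k) * monomialOfBits K (List.replicate k false ++ false :: γ) := by
      intro k _
      -- One `false` of the run is transferred to the front of `γ`.
      rw [Nat.add_sub_add_right, List.replicate_succ', List.append_assoc]
      rfl
    rw [sum_congr rfl h1, ih (fun j hj => H j (by omega))]
    simp only [List.replicate_zero, List.nil_append, Nat.sub_zero]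
    rw [H m (by omega) γ, extensionSum, smul_add]
    simp only [parts_false, length_addHead]
    rw [← add_assoc (parts γ).length m 1, Nat.choose_succ_succ _ m, add_smul, add_smul]
    abel

/-- Newton's recursion is multiplied on the right by the monomial function. Each `Ψ_{k+1}` then
splits in two, the sums over `k` involve only smaller cases, and absorption of binomials produces a
factor `m + 1`, which cancels. -/
theorem completeMulExpansion [CharZero K] (m : ℕ) : CompleteMulExpansion K m := by
  induction m using Nat.strong_induction_on with
  | _ m ih =>
    intro β
    set l := (parts β).length with hl
    have h0 : ((m + 1 : ℕ) : K) ≠ 0 := Nat.cast_ne_zero.2 (Nat.succ_ne_zero _)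
    have h1 := congrArg (· * monomialOfBits K β) (newton K m)
    simp only [sum_mul, mul_assoc, powerSum_mul_monomialOfBits, mul_add, sum_add_distrib,
      mul_smul_comm, ← smul_sum, sum_S_mul_monomialOfBits K m ih, parts_true, parts_false,
      length_addHead, List.length_cons, ← hl, smul_smul, smul_mul_assoc] at h1
    have e1 : (l + 1) * (l + 1 + m).choose m = (m + 1) * (l + m + 1).choose (m + 1) := by
      have := Nat.choose_succ_right_eq (l + m + 1) m
      rw [show l + m + 1 - m = l + 1 by omega] at this
      rw [show l + 1 + m = l + m + 1 by omega]
      linarith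
    have e2 : l * (l + m).choose m = (m + 1) * (l + m).choose (m + 1) := by
      have := Nat.choose_succ_right_eq (l + m) m
      rw [show l + m - m = l by omega] at this
      linarith
    rw [e1, e2, ← smul_smul, ← smul_smul, ← smul_add, ← Nat.cast_smul_eq_nsmul K (m + 1),
      ← Nat.cast_smul_eq_nsmul K (m + 1)] at h1
    exact smul_right_injective _ h0 h1

end Algebra

/-! ### Triangular matrices and quasideterminants over a noncommutative ring. -/

section Triangular

variable {R : Type*} [Ring R] {m : ℕ}

lemma isNilpotent_of_strictLower (N : Matrix (Fin m) (Fin m) R) (h : ∀ i j, i ≤ j → N i j = 0) :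
    IsNilpotent N := by
  -- Each further power clears one more diagonal.
  have key : ∀ (k : ℕ) (i j : Fin m), (i : ℕ) < j + k → (N ^ k) i j = 0 := by
    intro k
    induction k with
    | zero => intro i j hij; exact Matrix.one_apply_ne (by omega)
    | succ k ih =>
      intro i j hij
      rw [pow_succ, Matrix.mul_apply]
      refine sum_eq_zero fun l _ => ?_
      rcases le_or_gt l j with hl | hl
      · rw [h l j hl, mul_zero]
      · rw [ih i l (by omega), zero_mul]
  exact ⟨m, Matrix.ext fun i j => key m i j (by omega)⟩

/-- Dividing by the diagonal leaves `1 + N` with `N` strictly lower triangular, hence nilpotent; no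
commutativity is needed. -/
lemma isUnit_of_lowerTriangular (B : Matrix (Fin m) (Fin m) R) (h : ∀ i j, i < j → B i j = 0)
    (hd : ∀ i, IsUnit (B i i)) : IsUnit B := by
  choose d hd using hd
  have hdu : IsUnit (Matrix.diagonal fun i => (d i : R)) := by
    refine ⟨⟨Matrix.diagonal fun i => (d i : R), Matrix.diagonal fun i => ((d i)⁻¹ : Rˣ), ?_, ?_⟩,
      rfl⟩ <;> simp
  have hn : IsNilpotent ((Matrix.diagonal fun i => (((d i)⁻¹ : Rˣ) : R)) * B - 1) := by
    refine isNilpotent_of_strictLower _ fun i j hij => ?_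
    rw [Matrix.sub_apply, Matrix.diagonal_mul]
    rcases hij.eq_or_lt with rfl | hij
    · simp [← hd]
    · rw [h i j hij, Matrix.one_apply_ne hij.ne, mul_zero, sub_zero]
  have := hdu.mul hn.isUnit_one_add
  rwa [add_sub_cancel, ← mul_assoc, Matrix.diagonal_mul_diagonal, show
    (fun i => (d i : R) * ((d i)⁻¹ : Rˣ)) = fun _ => 1 by simp, Matrix.diagonal_one, one_mul] at this

/-- A quasideterminant at the first column, computed from a solution of the linear system given by
the other rows. -/
lemma quasidet_eq_of_solution (A : Matrix (Fin (m + 1)) (Fin (m + 1)) R) (p : Fin (m + 1))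
    (hA : IsUnit (A.submatrix p.succAbove (Fin.succAbove 0))) (x : Fin (m + 1) → R) (hx : x 0 = 1)
    (h : ∀ i, ∑ j, A (p.succAbove i) j * x j = 0) : quasidet A p 0 = ∑ j, A p j * x j := by
  -- Since `x 0 = 1`, the tail of `x` solves the reduced system with right-hand side minus the
  -- deleted column, so it is what the inverse in `quasidet` produces.
  have h1 : (A.submatrix p.succAbove (Fin.succAbove 0)).mulVec (fun j => x j.succ) =
      fun i => -A (p.succAbove i) 0 := by
    funext i
    have := h i
    rw [Fin.sum_univ_succ, hx, mul_one] at this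
    rw [eq_neg_iff_add_eq_zero, add_comm, ← this]
    simp [Matrix.mulVec, dotProduct]
  have h2 := congrArg (Ring.inverse (A.submatrix p.succAbove (Fin.succAbove 0))).mulVec h1
  rw [Matrix.mulVec_mulVec, Ring.inverse_mul_cancel _ hA, Matrix.one_mulVec] at h2
  rw [quasidet, Fin.sum_univ_succ, hx, mul_one, sub_eq_add_neg, ← sum_neg_distrib]
  congr 1
  refine sum_congr rfl fun j _ => ?_
  rw [congrFun h2 j, Matrix.mulVec, dotProduct, mul_sum, ← sum_neg_distrib]
  refine sum_congr rfl fun i _ => ?_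
  rw [mul_neg, mul_neg, mul_assoc, Fin.succAbove_zero]

end Triangular

lemma sum_take_drop_eq (L : List ℕ) (a t : ℕ) :
    ((L.drop a).take t).sum = ∑ q ∈ range t, L.getD (a + q) 0 := by
  induction t generalizing a L with
  | zero => simp
  | succ t ih =>
    rw [sum_range_succ', add_zero]
    by_cases ha : a < L.length
    · rw [List.drop_eq_getElem_cons ha, List.take_succ_cons, List.sum_cons, ih, add_comm,
        List.getD_eq_getElem _ _ ha]
      simp only [add_assoc, add_comm 1]
    · rw [List.drop_eq_nil_of_le (by omega), List.getD_eq_default _ _ (by omega)]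
      simp only [List.take_nil, List.sum_nil, add_zero]
      refine (sum_eq_zero fun q _ => List.getD_eq_default _ _ (by omega)).symm

lemma sum_Icc_eq_sum_take_drop {r : ℕ} (i : Fin r → ℕ) (a b : Fin r) :
    ∑ p ∈ Icc a b, i p = (((List.ofFn i).drop a).take (b + 1 - a)).sum := by
  rw [sum_take_drop_eq]
  -- The fallback value `b` is never reached on the range of summation.
  refine sum_nbij' (fun p => (p : ℕ) - a) (fun q => if h : (a : ℕ) + q < r then ⟨a + q, h⟩ else b)
    ?_ ?_ ?_ ?_ ?_
  · intro p hp
    simp only [mem_Icc, mem_range, Fin.le_def] at hp ⊢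
    omega
  · intro q hq
    simp only [mem_range] at hq
    rw [dif_pos (by omega)]
    simp only [mem_Icc, Fin.le_def]
    omega
  · intro p hp
    simp only [mem_Icc, Fin.le_def] at hp
    simp only [Nat.add_sub_cancel' hp.1, p.2, dite_true]
  · intro q hq
    simp only [mem_range] at hq
    rw [dif_pos (by omega)]
    simp
  · intro p hp
    simp only [mem_Icc, Fin.le_def] at hp
    rw [Nat.add_sub_cancel' hp.1, List.getD_eq_getElem _ _ (by simp)]
    simp

/-! ### The quasideterminant satisfies the two-term recursion. -/

section Algebra

variable (K : Type*) [Field K] [CharZero K]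

/-- The two-term recursion iterated until the list is exhausted: each step merges one more part into
the leading power sum and changes the sign. -/
lemma length_smul_monomialOfList (i : ℕ) (L : List ℕ) :
    (L.length + 1) • monomialOfList K (i :: L) = ∑ s ∈ range (L.length + 1),
      (-1) ^ s * (powerSum K (i + (L.take s).sum) * monomialOfList K (L.drop s)) := by
  induction L generalizing i with
  | nil => simp [monomialOfList]
  | cons j L ih =>
    rw [eq_sub_of_add_eq (powerSum_mul_monomialOfList K i (j :: L)).symm, sum_range_succ',
      addHead_cons, List.length_cons, ih (i + j), sub_eq_add_neg, add_comm, ← sum_neg_distrib]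
    simp [pow_succ, add_assoc]

lemma length_smul_monomialOfList_drop {r : ℕ} (i : Fin r → ℕ) (k : Fin r) :
    ∑ j ∈ univ.filter (· ≤ k), powerSum K (∑ p ∈ Icc k.rev j.rev, i p) *
      ((-1) ^ (j : ℕ) * monomialOfList K ((List.ofFn i).drop (r - j))) =
    (-1) ^ (k : ℕ) * ((k + 1 : ℕ) •
      monomialOfList K ((List.ofFn i).drop (r - (k + 1)))) := by
  have hk : r - (k + 1) < (List.ofFn i).length := by rw [List.length_ofFn]; omega
  have hlen : ((List.ofFn i).drop (r - (k + 1) + 1)).length = k := by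
    rw [List.length_drop, List.length_ofFn]; omega
  have h := length_smul_monomialOfList K (List.ofFn i)[r - (k + 1)]
    ((List.ofFn i).drop (r - (k + 1) + 1))
  rw [← List.drop_eq_getElem_cons hk, hlen] at h
  rw [h, mul_sum]
  refine sum_nbij' (fun j => (k : ℕ) - j) (fun s => ⟨k - s, by omega⟩) ?_ ?_ ?_ ?_ ?_
  · intro j hj
    simp only [mem_filter, mem_univ, true_and, Fin.le_def, mem_range] at hj ⊢
    omega
  · intro s hs
    rw [mem_filter, Fin.le_def]
    exact ⟨mem_univ _, Nat.sub_le _ _⟩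
  · intro j hj
    simp only [mem_filter, mem_univ, true_and, Fin.le_def] at hj
    ext
    simp only
    omega
  · intro s hs
    simp only [mem_range] at hs
    simp only
    omega
  · intro j hj
    simp only [mem_filter, mem_univ, true_and, Fin.le_def] at hj
    rw [sum_Icc_eq_sum_take_drop, Fin.val_rev, Fin.val_rev,
      show r - (j + 1) + 1 - (r - (k + 1)) = (k - j : ℕ) + 1 by omega,
      List.drop_eq_getElem_cons hk, List.take_succ_cons, List.sum_cons, List.drop_drop,
      show r - (k + 1) + 1 + (k - j : ℕ) = r - j by omega, ← mul_assoc, ← mul_assoc, ← mul_assoc,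
      ← pow_add, ((Commute.neg_one_right _).pow_right _).eq]
    congr 2
    obtain ⟨t, ht⟩ := Nat.exists_eq_add_of_le hj
    rw [ht, Nat.add_sub_cancel_left, add_assoc, pow_add, ← two_mul, pow_mul, neg_one_sq, one_pow,
      mul_one]

/-- The candidate solution has as entry `j` the signed monomial function of the last `j` parts. The
entries up to the diagonal sum to a multiple of the next one, which the superdiagonal entry `k + 1`
cancels; only the last row has no superdiagonal entry. -/
lemma monomialMatrix_row {m : ℕ} (i : Fin (m + 1) → ℕ) (k : Fin (m + 1)) :
    ∑ j, monomialMatrix K i k j *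
      ((-1) ^ (j : ℕ) * monomialOfList K ((List.ofFn i).drop (m + 1 - j))) =
    if k = Fin.last m then (-1) ^ m * ((m + 1) • monomialOfList K (List.ofFn i)) else 0 := by
  rw [← sum_filter_add_sum_filter_not univ (· ≤ k)]
  have h1 : ∀ j ∈ univ.filter (· ≤ k), monomialMatrix K i k j *
      ((-1) ^ (j : ℕ) * monomialOfList K ((List.ofFn i).drop (m + 1 - j))) =
      powerSum K (∑ p ∈ Icc k.rev j.rev, i p) *
      ((-1) ^ (j : ℕ) * monomialOfList K ((List.ofFn i).drop (m + 1 - j))) := by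
    intro j hj
    simp only [mem_filter, mem_univ, true_and] at hj
    simp [monomialMatrix, hj]
  rw [sum_congr rfl h1, length_smul_monomialOfList_drop]
  split_ifs with hk
  · subst hk
    rw [sum_eq_zero, add_zero]
    · simp
    · intro j hj
      simp only [mem_filter, mem_univ, true_and, not_le] at hj
      exact absurd (Fin.le_last j) (not_le.2 hj)
  · have hkm : (k : ℕ) < m := by
      have := Fin.val_lt_last hk
      simpa using this
    rw [sum_eq_single (⟨k + 1, by omega⟩ : Fin (m + 1))]
    · have hk' : ¬ (⟨k + 1, by omega⟩ : Fin (m + 1)) ≤ k := by rw [Fin.le_def]; simp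
      simp only [monomialMatrix, Matrix.of_apply, hk', if_false, if_true]
      rw [← mul_assoc, Nat.cast_comm, mul_assoc, ← nsmul_eq_mul, pow_succ, mul_assoc,
        neg_one_mul, mul_neg, add_neg_cancel]
    · intro j hj hne
      simp only [mem_filter, mem_univ, true_and] at hj
      have : (j : ℕ) ≠ k + 1 := fun h => hne (Fin.ext h)
      simp [monomialMatrix, hj, this]
    · intro h
      rw [mem_filter, Fin.le_def] at h
      simp at h

theorem monomialOfParts_eq {r : ℕ} (i : Fin r → ℕ) :
    monomialOfParts K i = monomialOfList K (List.ofFn i) := by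
  cases r with
  | zero => simp [monomialOfParts, monomialOfList]
  | succ m =>
    have hm : ((m + 1 : ℕ) : K) ≠ 0 := Nat.cast_ne_zero.2 (Nat.succ_ne_zero _)
    rw [monomialOfParts, quasidet_eq_of_solution _ _ _
      (fun j => (-1) ^ (j : ℕ) * monomialOfList K ((List.ofFn i).drop (m + 1 - j))),
      monomialMatrix_row, if_pos rfl, ← mul_assoc, ← pow_add, ← two_mul, pow_mul, neg_one_sq,
      one_pow, one_mul, ← Nat.cast_smul_eq_nsmul K, smul_smul, inv_mul_cancel₀ hm, one_smul]
    · simp only [Fin.val_zero, pow_zero, one_mul, Nat.sub_zero]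
      rw [List.drop_eq_nil_of_le (by simp), monomialOfList]
    · intro l
      rw [monomialMatrix_row, if_neg]
      simp
    · refine isUnit_of_lowerTriangular _ (fun a b hab => ?_) fun a => ?_
      · have h1 : ¬ b.succ ≤ a.castSucc := by
          rw [Fin.lt_def] at hab; rw [Fin.le_def, Fin.val_succ, Fin.val_castSucc]; omega
        have h2 : (b : ℕ) ≠ a := by rw [Fin.lt_def] at hab; omega
        simp [monomialMatrix, h1, h2]
      · have h1 : ¬ a.succ ≤ a.castSucc := by rw [Fin.le_def]; simp
        have h3 : ((a + 1 : ℕ) : K) ≠ 0 := Nat.cast_ne_zero.2 (Nat.succ_ne_zero _)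
        have h2 := (Ne.isUnit h3).map (algebraMap K (Sym K))
        rw [map_natCast] at h2
        simpa [monomialMatrix, h1] using h2

lemma Psi_eq {n : ℕ} (I : Composition n) : Psi K I = monomialOfList K I.blocks := by
  rw [Psi, monomialOfParts_eq, Composition.ofFn_blocksFun]

end Algebra

/-! ### Packed words built by prepending letters. -/

section Words

variable {n : ℕ}

/-- The number of distinct letters of a word. -/
def numLetters (u : Fin n → ℕ) : ℕ := #(univ.image u)

lemma isPacked_of_image_eq {u : Fin n → ℕ} {l : ℕ} (h : univ.image u = Icc 1 l) : IsPacked u := by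
  funext i
  have hi : u i ∈ Icc 1 l := h ▸ mem_image_of_mem u (mem_univ i)
  rw [mem_Icc] at hi
  have : {b ∈ Icc 1 l | b ≤ u i} = Icc 1 (u i) := by
    ext b
    simp only [mem_filter, mem_Icc]
    omega
  simp [pack, h, this]

lemma IsPacked.image_eq {u : Fin n → ℕ} (h : IsPacked u) :
    univ.image u = Icc 1 (numLetters u) := by
  refine eq_of_subset_of_card_le (fun x hx => ?_) (by simp [numLetters])
  obtain ⟨i, -, rfl⟩ := mem_image.1 hx
  have h1 : pack u i = u i := congrFun h i
  rw [mem_Icc]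
  constructor
  · rw [← h1, pack, Nat.one_le_iff_ne_zero, ← Nat.pos_iff_ne_zero, card_pos]
    exact ⟨u i, by simp⟩
  · rw [← h1, pack]
    exact card_filter_le _ _

lemma IsPacked.exists_eq_iff {u : Fin n → ℕ} (h : IsPacked u) (x : ℕ) :
    (∃ i, u i = x) ↔ 1 ≤ x ∧ x ≤ numLetters u := by
  have := Finset.ext_iff.1 h.image_eq x
  simpa using this

lemma IsPacked.pos {u : Fin n → ℕ} (h : IsPacked u) (i : Fin n) : 1 ≤ u i :=
  ((h.exists_eq_iff _).1 ⟨i, rfl⟩).1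

lemma IsPacked.le_numLetters {u : Fin n → ℕ} (h : IsPacked u) (i : Fin n) : u i ≤ numLetters u :=
  ((h.exists_eq_iff _).1 ⟨i, rfl⟩).2

lemma isPacked_of_forall {u : Fin n → ℕ} {l : ℕ}
    (h : ∀ x, (∃ i, u i = x) ↔ 1 ≤ x ∧ x ≤ l) : IsPacked u ∧ numLetters u = l := by
  have h1 : univ.image u = Icc 1 l := by
    ext x
    simpa using h x
  exact ⟨isPacked_of_image_eq h1, by simp [numLetters, h1]⟩

/-- Prepends to `v` a new letter `b + 1`, shifting the letters of `v` larger than `b`. -/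
def insertLetter (v : Fin n → ℕ) (b : ℕ) : Fin (n + 1) → ℕ :=
  Fin.cons (b + 1) fun i => if b < v i then v i + 1 else v i

/-- Prepends the letter `b + 1` to `v`. -/
def repeatLetter (v : Fin n → ℕ) (b : ℕ) : Fin (n + 1) → ℕ := Fin.cons (b + 1) v

/-- The word `v` such that `insertLetter v (u 0 - 1) = u`, if the first letter of `u` occurs once. -/
def removeLetter (u : Fin (n + 1) → ℕ) : Fin n → ℕ :=
  fun i => if u 0 < u i.succ then u i.succ - 1 else u i.succ

lemma isPacked_insertLetter {v : Fin n → ℕ} (hv : IsPacked v) {b : ℕ} (hb : b ≤ numLetters v) :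
    IsPacked (insertLetter v b) := by
  refine (isPacked_of_forall (l := numLetters v + 1) fun x => ?_).1
  rw [Fin.exists_fin_succ]
  simp only [insertLetter, Fin.cons_zero, Fin.cons_succ]
  constructor
  · rintro (rfl | ⟨i, rfl⟩)
    · omega
    · have := hv.pos i
      have := hv.le_numLetters i
      split_ifs <;> omega
  · intro hx
    rcases lt_trichotomy x (b + 1) with h | h | h
    · obtain ⟨i, hi⟩ := (hv.exists_eq_iff x).2 (by omega)
      exact Or.inr ⟨i, by rw [if_neg (by omega), hi]⟩
    · exact Or.inl h.symm
    · obtain ⟨i, hi⟩ := (hv.exists_eq_iff (x - 1)).2 (by omega)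
      exact Or.inr ⟨i, by rw [if_pos (by omega), hi]; omega⟩

lemma isPacked_repeatLetter {v : Fin n → ℕ} (hv : IsPacked v) {b : ℕ} (hb : b < numLetters v) :
    IsPacked (repeatLetter v b) := by
  refine (isPacked_of_forall (l := numLetters v) fun x => ?_).1
  rw [Fin.exists_fin_succ]
  simp only [repeatLetter, Fin.cons_zero, Fin.cons_succ, hv.exists_eq_iff]
  omega

lemma removeLetter_spec {u : Fin (n + 1) → ℕ} (hu : IsPacked u) (h : ∀ i : Fin n, u i.succ ≠ u 0) :
    IsPacked (removeLetter u) ∧ u 0 - 1 ≤ numLetters (removeLetter u) := by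
  have h0 := hu.pos 0
  have h0' := hu.le_numLetters 0
  have key := isPacked_of_forall (u := removeLetter u) (l := numLetters u - 1) fun x => by
    simp only [removeLetter]
    constructor
    · rintro ⟨i, rfl⟩
      have := hu.pos i.succ
      have := hu.le_numLetters i.succ
      have := h i
      split_ifs <;> omega
    · intro hx
      rcases lt_or_ge x (u 0) with hlt | hge
      · obtain ⟨i, hi⟩ := (hu.exists_eq_iff x).2 (by omega)
        obtain ⟨i, rfl⟩ := Fin.exists_succ_eq_of_ne_zero (x := i) (by rintro rfl; omega)
        exact ⟨i, by rw [if_neg (by omega), hi]⟩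
      · obtain ⟨i, hi⟩ := (hu.exists_eq_iff (x + 1)).2 (by omega)
        obtain ⟨i, rfl⟩ := Fin.exists_succ_eq_of_ne_zero (x := i) (by rintro rfl; omega)
        exact ⟨i, by rw [if_pos (by omega), hi]; omega⟩
  exact ⟨key.1, by omega⟩

lemma tail_spec {u : Fin (n + 1) → ℕ} (hu : IsPacked u) (h : ∃ i : Fin n, u i.succ = u 0) :
    IsPacked (fun i : Fin n => u i.succ) ∧ u 0 - 1 < numLetters (fun i : Fin n => u i.succ) := by
  have h0 := hu.pos 0
  have h0' := hu.le_numLetters 0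
  have key := isPacked_of_forall (u := fun i : Fin n => u i.succ) (l := numLetters u) fun x => by
    rw [← hu.exists_eq_iff, Fin.exists_fin_succ]
    constructor
    · exact Or.inr
    · rintro (rfl | h')
      · exact h
      · exact h'
  exact ⟨key.1, by omega⟩

/-- The packed words of length `n`. -/
def packedWords (n : ℕ) : Finset (Fin n → ℕ) := (finite_packedWords n).toFinset

@[simp] lemma mem_packedWords {u : Fin n → ℕ} : u ∈ packedWords n ↔ IsPacked u := by
  simp [packedWords]

/-- The two sums correspond to whether the first letter occurs again; deleting it and, in the first
case, closing the gap among the letters inverts the construction. -/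
theorem sum_packedWords_succ {M : Type*} [AddCommMonoid M] (f : (Fin (n + 1) → ℕ) → M) :
    ∑ u ∈ packedWords (n + 1), f u = ∑ v ∈ packedWords n,
      (∑ b ∈ range (numLetters v + 1), f (insertLetter v b) +
        ∑ b ∈ range (numLetters v), f (repeatLetter v b)) := by
  classical
  rw [← sum_filter_add_sum_filter_not _ (fun u => ∀ i : Fin n, u i.succ ≠ u 0), sum_add_distrib]
  congr 1
  · rw [sum_sigma']
    have hinv : ∀ u ∈ {u ∈ packedWords (n + 1) | ∀ i : Fin n, u i.succ ≠ u 0},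
        insertLetter (removeLetter u) (u 0 - 1) = u := by
      intro u hu
      rw [mem_filter, mem_packedWords] at hu
      have h0 := hu.1.pos 0
      funext i
      refine Fin.cases ?_ (fun i => ?_) i
      · simp only [insertLetter, Fin.cons_zero]
        omega
      · have := hu.2 i
        simp only [insertLetter, removeLetter, Fin.cons_succ]
        split_ifs <;> omega
    refine sum_nbij' (fun u => ⟨removeLetter u, u 0 - 1⟩) (fun p => insertLetter p.1 p.2)
      ?_ ?_ hinv ?_ fun u hu => by rw [hinv u hu]
    · intro u hu
      rw [mem_filter, mem_packedWords] at hu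
      have := removeLetter_spec hu.1 hu.2
      simpa [Nat.lt_succ_iff] using this
    · rintro ⟨v, b⟩ h
      simp only [mem_sigma, mem_packedWords, mem_range, Nat.lt_succ_iff] at h
      rw [mem_filter, mem_packedWords]
      refine ⟨isPacked_insertLetter h.1 h.2, fun i => ?_⟩
      simp only [insertLetter, Fin.cons_succ, Fin.cons_zero]
      split_ifs <;> omega
    · rintro ⟨v, b⟩ -
      congr 1
      funext i
      simp only [insertLetter, removeLetter, Fin.cons_zero, Fin.cons_succ]
      split_ifs <;> omega
  · rw [sum_sigma']
    have hinv : ∀ u ∈ {u ∈ packedWords (n + 1) | ¬ ∀ i : Fin n, u i.succ ≠ u 0},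
        repeatLetter (fun i => u i.succ) (u 0 - 1) = u := by
      intro u hu
      rw [mem_filter, mem_packedWords] at hu
      have h0 := hu.1.pos 0
      funext i
      refine Fin.cases ?_ (fun i => ?_) i
      · simp only [repeatLetter, Fin.cons_zero]
        omega
      · simp [repeatLetter]
    refine sum_nbij' (fun u => ⟨fun i => u i.succ, u 0 - 1⟩) (fun p => repeatLetter p.1 p.2)
      ?_ ?_ hinv ?_ fun u hu => by rw [hinv u hu]
    · intro u hu
      rw [mem_filter, mem_packedWords] at hu
      have := tail_spec hu.1 (by simpa using hu.2)
      simpa using this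
    · rintro ⟨v, b⟩ h
      simp only [mem_sigma, mem_packedWords, mem_range] at h
      rw [mem_filter, mem_packedWords]
      refine ⟨isPacked_repeatLetter h.1 h.2, ?_⟩
      obtain ⟨i, hi⟩ := (h.1.exists_eq_iff (b + 1)).2 (by omega)
      push Not
      exact ⟨i, by simpa [repeatLetter] using hi⟩
    · rintro ⟨v, b⟩ -
      simp [repeatLetter]

/-- The bits marking the positions of the last occurrences of the letters of a word. -/
def lastBits (u : Fin n → ℕ) : List Bool :=
  List.ofFn fun i => decide (∀ j, i < j → u j ≠ u i)

lemma lastBits_succ (u : Fin (n + 1) → ℕ) :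
    lastBits u = decide (∀ j : Fin n, u j.succ ≠ u 0) :: lastBits fun i => u i.succ := by
  rw [lastBits, List.ofFn_succ, lastBits]
  congr 1
  · simp [Fin.forall_fin_succ]
  · simp [Fin.forall_fin_succ]

/-- Each letter has exactly one last occurrence. This matches the numbers of prepending choices with
the coefficients `ℓ + 1` and `ℓ` of the algebra. -/
lemma length_parts_lastBits (u : Fin n → ℕ) : (parts (lastBits u)).length = numLetters u := by
  induction n with
  | zero => simp [lastBits, numLetters]
  | succ n ih =>
    have himg : univ.image u = insert (u 0) (univ.image fun i : Fin n => u i.succ) := by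
      ext x
      simp [Fin.exists_fin_succ, eq_comm]
    rw [lastBits_succ, numLetters, himg]
    by_cases h : ∀ j : Fin n, u j.succ ≠ u 0
    · rw [card_insert_of_notMem (by simpa using h)]
      simp [h, ih, numLetters]
    · rw [card_insert_of_mem (by simpa using h)]
      simp [h, ih, numLetters]

lemma lastBits_insertLetter (v : Fin n → ℕ) (b : ℕ) :
    lastBits (insertLetter v b) = true :: lastBits v := by
  rw [lastBits_succ]
  congr 1
  · rw [decide_eq_true_iff]
    intro j
    simp only [insertLetter, Fin.cons_succ, Fin.cons_zero]
    split_ifs <;> omega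
  · simp only [lastBits, insertLetter, Fin.cons_succ]
    congr 1
    funext i
    congr 1
    refine propext (forall₂_congr fun j _ => ?_)
    split_ifs <;> omega

lemma lastBits_repeatLetter {v : Fin n → ℕ} (hv : IsPacked v) {b : ℕ} (hb : b < numLetters v) :
    lastBits (repeatLetter v b) = false :: lastBits v := by
  rw [lastBits_succ]
  congr 1
  rw [decide_eq_false_iff_not]
  push Not
  obtain ⟨i, hi⟩ := (hv.exists_eq_iff (b + 1)).2 (by omega)
  exact ⟨i, by simpa [repeatLetter] using hi⟩

/-- The first letter of a word, diminished by one. -/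
def firstLetter (u : Fin n → ℕ) : ℕ := if h : 0 < n then u ⟨0, h⟩ - 1 else 0

/-- All descents of `u` are at positions marked by `δ`. -/
def AllowsDescents (δ : List Bool) (u : Fin n → ℕ) : Prop :=
  ∀ (i : ℕ) (h : i + 1 < n), u ⟨i + 1, h⟩ < u ⟨i, by omega⟩ → δ[i]? = some true

lemma allowsDescents_cons (ε : Bool) (δ : List Bool) (u : Fin (n + 1) → ℕ) :
    AllowsDescents (ε :: δ) u ↔ (∀ h : 0 < n, u (Fin.succ ⟨0, h⟩) < u 0 → ε = true) ∧
      AllowsDescents δ fun i => u i.succ := by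
  constructor
  · intro h
    refine ⟨fun h0 hlt => ?_, fun i hi hlt => ?_⟩
    · simpa using h 0 (by omega) hlt
    · simpa using h (i + 1) (by omega) hlt
  · rintro ⟨h1, h2⟩ (_ | i) hi hlt
    · simpa using h1 (by omega) hlt
    · simpa using h2 i (by omega) hlt

lemma allowsDescents_insertLetter_tail (δ : List Bool) (v : Fin n → ℕ) (b : ℕ) :
    AllowsDescents δ (fun i : Fin n => insertLetter v b i.succ) ↔ AllowsDescents δ v := by
  refine forall₂_congr fun i h => imp_congr_left ?_
  simp only [insertLetter, Fin.cons_succ]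
  split_ifs <;> omega

lemma allowsDescents_true_insertLetter (δ : List Bool) (v : Fin n → ℕ) (b : ℕ) :
    AllowsDescents (true :: δ) (insertLetter v b) ↔ AllowsDescents δ v := by
  simp [allowsDescents_cons, allowsDescents_insertLetter_tail]

lemma allowsDescents_true_repeatLetter (δ : List Bool) (v : Fin n → ℕ) (b : ℕ) :
    AllowsDescents (true :: δ) (repeatLetter v b) ↔ AllowsDescents δ v := by
  simp [allowsDescents_cons, repeatLetter]

/-- The shift lets the new letter `b + 1` precede an old first letter equal to `b + 1` without a
descent, so the bound on `b` is the same as for a repeated letter. -/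
lemma allowsDescents_false_insertLetter (δ : List Bool) {v : Fin (n + 1) → ℕ} (hv : IsPacked v)
    (b : ℕ) : AllowsDescents (false :: δ) (insertLetter v b) ↔
      b ≤ firstLetter v ∧ AllowsDescents δ v := by
  have := hv.pos 0
  rw [allowsDescents_cons, allowsDescents_insertLetter_tail]
  simp only [insertLetter, firstLetter, Fin.cons_succ, Fin.cons_zero, Nat.zero_lt_succ, dite_true,
    forall_true_left, Bool.false_eq_true, imp_false, Fin.zero_eta]
  refine and_congr_left fun _ => ?_
  split_ifs <;> omega

lemma allowsDescents_false_repeatLetter (δ : List Bool) {v : Fin (n + 1) → ℕ} (hv : IsPacked v)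
    (b : ℕ) : AllowsDescents (false :: δ) (repeatLetter v b) ↔
      b ≤ firstLetter v ∧ AllowsDescents δ v := by
  have := hv.pos 0
  rw [allowsDescents_cons]
  simp only [repeatLetter, firstLetter, Fin.cons_succ, Fin.cons_zero, Nat.zero_lt_succ, dite_true,
    forall_true_left, Bool.false_eq_true, imp_false, Fin.zero_eta]
  refine and_congr_left fun _ => ?_
  omega

@[simp] lemma firstLetter_insertLetter (v : Fin n → ℕ) (b : ℕ) :
    firstLetter (insertLetter v b) = b := by
  simp [firstLetter, insertLetter]

@[simp] lemma firstLetter_repeatLetter (v : Fin n → ℕ) (b : ℕ) :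
    firstLetter (repeatLetter v b) = b := by
  simp [firstLetter, repeatLetter]

end Words

/-! ### Sums over packed words with prescribed possible descents. -/

section DescentSum

variable {M : Type*} [AddCommMonoid M]

open Classical in
/-- The sum of `f` of the first letter and of the last-occurrence bits, over the packed words of
length `n` whose descents are marked by `δ`. -/
def descentSum (n : ℕ) (δ : List Bool) (f : ℕ → List Bool → M) : M :=
  ∑ u ∈ packedWords n with AllowsDescents δ u, f (firstLetter u) (lastBits u)

lemma descentSum_true (n : ℕ) (δ : List Bool) (f : ℕ → List Bool → M) :
    descentSum (n + 1) (true :: δ) f = descentSum n δ fun _ β =>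
      ∑ b ∈ range ((parts β).length + 1), f b (true :: β) +
        ∑ b ∈ range (parts β).length, f b (false :: β) := by
  classical
  rw [descentSum, descentSum, sum_filter, sum_packedWords_succ, sum_filter]
  refine sum_congr rfl fun v hv => ?_
  rw [mem_packedWords] at hv
  simp only [allowsDescents_true_insertLetter, allowsDescents_true_repeatLetter,
    lastBits_insertLetter, firstLetter_insertLetter, firstLetter_repeatLetter,
    length_parts_lastBits]
  split_ifs
  · congr 1
    refine sum_congr rfl fun b hb => ?_
    rw [lastBits_repeatLetter hv (mem_range.1 hb)]
  · simp

lemma descentSum_false (n : ℕ) (δ : List Bool) (f : ℕ → List Bool → M) :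
    descentSum (n + 2) (false :: δ) f = descentSum (n + 1) δ fun a β =>
      ∑ b ∈ range (a + 1), (f b (true :: β) + f b (false :: β)) := by
  classical
  rw [descentSum, descentSum, sum_filter, sum_packedWords_succ, sum_filter]
  refine sum_congr rfl fun v hv => ?_
  rw [mem_packedWords] at hv
  -- This makes the bound `b ≤ firstLetter v` the binding one in both ranges, so new and repeated
  -- letters contribute over the same `b`.
  have hfirst : firstLetter v < numLetters v := by
    have h1 := hv.pos 0
    have h2 := hv.le_numLetters 0
    simp only [firstLetter, Nat.zero_lt_succ, dite_true, Fin.zero_eta]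
    omega
  simp only [allowsDescents_false_insertLetter δ hv, allowsDescents_false_repeatLetter δ hv,
    lastBits_insertLetter, firstLetter_insertLetter, firstLetter_repeatLetter]
  by_cases hδ : AllowsDescents δ v
  · simp only [hδ, and_true, if_true]
    rw [← sum_filter, ← sum_filter, sum_add_distrib]
    have h1 : {b ∈ range (numLetters v + 1) | b ≤ firstLetter v} = range (firstLetter v + 1) := by
      ext b
      simp only [mem_filter, mem_range]
      omega
    have h2 : {b ∈ range (numLetters v) | b ≤ firstLetter v} = range (firstLetter v + 1) := by
      ext b
      simp only [mem_filter, mem_range]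
      omega
    rw [h1, h2]
    congr 1
    refine sum_congr rfl fun b hb => ?_
    rw [mem_range] at hb
    rw [lastBits_repeatLetter hv (by omega)]
  · simp [hδ]

end DescentSum

/-! ### Complete products as sums over packed words. -/

section Products

variable (K : Type*) [Field K]

/-- Each `false` forces a weak ascent, so `b` runs up to the next letter; the hockey-stick identity
raises the binomial by one, and the choice between a new and a repeated letter adds one free bit. -/
lemma descentSum_replicate (n j t : ℕ) (δ : List Bool) :
    descentSum (j + n + 1) (List.replicate j false ++ true :: δ)
      (fun b β => (b + t).choose t • extensionSum K t β) =
    descentSum (n + 1) (true :: δ)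
      (fun b β => (b + (t + j)).choose (t + j) • extensionSum K (t + j) β) := by
  induction j generalizing t with
  | zero => simp
  | succ j ih =>
    rw [show j + 1 + n + 1 = j + n + 2 by ring, List.replicate_succ, List.cons_append,
      descentSum_false]
    simp only [← smul_add, ← extensionSum_succ, ← sum_smul, Nat.sum_range_add_choose]
    have := ih (t + 1)
    simp only [← add_assoc] at this
    rw [this, show t + (j + 1) = t + 1 + j by ring]
    simp only [← add_assoc]

/-- At the `true` that ends the block the letter is unconstrained, and a last hockey-stick summation
yields exactly the two binomials of `completeMulExpansion`. -/
lemma descentSum_block [CharZero K] (n j : ℕ) (δ : List Bool) :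
    descentSum (j + n + 1) (List.replicate j false ++ true :: δ) (fun _ => monomialOfBits K) =
      S K (j + 1) * descentSum n δ (fun _ => monomialOfBits K) := by
  have h := descentSum_replicate K n j 0 δ
  simp only [Nat.choose_zero_right, one_smul, extensionSum, zero_add] at h
  rw [h, descentSum_true]
  simp only [← sum_smul, Nat.sum_range_add_choose]
  rw [descentSum, descentSum, mul_sum]
  refine sum_congr rfl fun v _ => ?_
  rw [completeMulExpansion K j]
  congr 2
  -- With no parts, the empty sum matches the vanishing `(0 + j).choose (j + 1)`.
  cases (parts (lastBits v)).length with
  | zero => simp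
  | succ l => rw [Nat.sum_range_add_choose, add_right_comm]

/-- The bits marking the last cells of the parts of a composition. -/
def bits : List ℕ → List Bool
  | [] => []
  | m :: P => List.replicate (m - 1) false ++ true :: bits P

lemma parts_bits {P : List ℕ} (hP : ∀ m ∈ P, 0 < m) : parts (bits P) = P := by
  induction P with
  | nil => rfl
  | cons m P ih =>
    have := hP m (by simp)
    rw [bits, parts_replicate, parts_true, addHead_cons, ih fun a ha => hP a (by simp [ha]),
      Nat.sub_add_cancel this]

theorem descentSum_bits [CharZero K] {P : List ℕ} (hP : ∀ m ∈ P, 0 < m) :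
    descentSum P.sum (bits P) (fun _ => monomialOfBits K) = (P.map (S K)).prod := by
  induction P with
  | nil =>
    have h : packedWords 0 = {![]} := by
      ext u
      simp only [mem_packedWords, mem_singleton]
      exact ⟨fun _ => Subsingleton.elim _ _, fun _ => Subsingleton.elim _ _⟩
    classical
    have hd : AllowsDescents (bits []) (![] : Fin 0 → ℕ) := fun i hi => by omega
    rw [List.sum_nil, descentSum, h, filter_singleton, if_pos hd]
    simp [lastBits, monomialOfBits, monomialOfList]
  | cons m P ih =>
    obtain ⟨j, rfl⟩ := Nat.exists_eq_succ_of_ne_zero (hP m (by simp)).ne'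
    rw [List.sum_cons, bits, Nat.succ_eq_add_one, add_right_comm, Nat.add_sub_cancel,
      descentSum_block, ih fun a ha => hP a (by simp [ha]), List.map_cons, List.prod_cons]

end Products

/-! ### Boundaries of compositions, bits, and Möbius inversion. -/

section Compositions

lemma exists_sum_take_cons (a : ℕ) (L : List ℕ) (x : ℕ) :
    (∃ k, ((a :: L).take k).sum = x) ↔ x = 0 ∨ ∃ k, a + (L.take k).sum = x := by
  constructor
  · rintro ⟨_ | k, h⟩
    · exact Or.inl (by simpa using h.symm)
    · exact Or.inr ⟨k, by simpa using h⟩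
  · rintro (rfl | ⟨k, h⟩)
    · exact ⟨0, by simp⟩
    · exact ⟨k + 1, by simpa using h⟩

lemma parts_pos (β : List Bool) : ∀ m ∈ parts β, 0 < m := by
  induction β with
  | nil => simp
  | cons ε β ih =>
    cases ε with
    | true => simpa using ih
    | false =>
      rw [parts_false]
      cases h : parts β with
      | nil => simp
      | cons j L =>
        rw [h] at ih
        simp only [addHead_cons, List.mem_cons, forall_eq_or_imp] at ih ⊢
        exact ⟨by omega, ih.2⟩

lemma getLast?_ne_of_cons {ε : Bool} {β : List Bool} (h : (ε :: β).getLast? ≠ some false) :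
    β.getLast? ≠ some false := by
  cases β with
  | nil => simp
  | cons ε' β => rwa [List.getLast?_cons_cons] at h

/-- Without the hypothesis, the cells of a trailing run of `false` would be lost. -/
lemma sum_parts {β : List Bool} (h : β.getLast? ≠ some false) : (parts β).sum = β.length := by
  induction β with
  | nil => rfl
  | cons ε β ih =>
    have ih := ih (getLast?_ne_of_cons h)
    cases ε with
    | true => simp [ih, add_comm]
    | false =>
      cases β with
      | nil => simp at h
      | cons ε' β =>
        rw [parts_false]
        cases hp : parts (ε' :: β) with
        | nil => simp [hp] at ih
        | cons j L =>
          rw [hp] at ih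
          simp only [addHead_cons, List.sum_cons, List.length_cons] at ih ⊢
          omega

/-- Bits are numbered from `0`, so a part closed by bit `p` ends at the partial sum `p + 1`. -/
lemma exists_sum_take_parts_iff {β : List Bool} (h : β.getLast? ≠ some false) (p : ℕ) :
    (∃ k, ((parts β).take k).sum = p + 1) ↔ β[p]? = some true := by
  induction β generalizing p with
  | nil => simp
  | cons ε β ih =>
    have hβ := getLast?_ne_of_cons h
    have ih := ih hβ
    cases ε with
    | true =>
      rw [parts_true, exists_sum_take_cons]
      cases p with
      | zero => simpa using ⟨0, by simp⟩
      | succ p =>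
        rw [List.getElem?_cons_succ, ← ih]
        simp [add_comm 1]
    | false =>
      rw [parts_false]
      cases hp : parts β with
      | nil =>
        have := sum_parts hβ
        rw [hp, List.sum_nil, eq_comm, List.length_eq_zero_iff] at this
        simp [this] at h
      | cons j L =>
        have hj := parts_pos β j (by simp [hp])
        simp only [hp, exists_sum_take_cons] at ih
        rw [addHead_cons, exists_sum_take_cons]
        cases p with
        | zero =>
          simp only [List.getElem?_cons_zero, Option.some.injEq, Bool.false_eq_true, iff_false]
          rintro (h | ⟨k, hk⟩) <;> omega
        | succ p =>
          rw [List.getElem?_cons_succ, ← ih]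
          simp only [Nat.add_eq_zero_iff, one_ne_zero, and_false, false_or]
          exact exists_congr fun k => by omega

lemma getLast?_bits_ne (P : List ℕ) : (bits P).getLast? ≠ some false := by
  induction P with
  | nil => simp [bits]
  | cons m P ih =>
    rw [bits, List.getLast?_append]
    cases h : bits P with
    | nil => simp
    | cons ε β =>
      rw [List.getLast?_cons_cons, ← h]
      cases h' : (bits P).getLast? with
      | none => simp [h] at h'
      | some b => simpa [h'] using ih

lemma getLast?_lastBits_ne {n : ℕ} (u : Fin n → ℕ) : (lastBits u).getLast? ≠ some false := by
  induction n with
  | zero => simp [lastBits]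
  | succ n ih =>
    rw [lastBits_succ]
    cases h : lastBits fun i : Fin n => u i.succ with
    | nil =>
      have hn : n = 0 := by simpa [lastBits] using congrArg List.length h
      subst hn
      simp
    | cons ε β =>
      rw [List.getLast?_cons_cons, ← h]
      exact ih _

variable {n : ℕ}

lemma mem_boundaries_iff (c : Composition n) (p : Fin (n + 1)) :
    p ∈ c.boundaries ↔ ∃ k, (c.blocks.take k).sum = p := by
  rw [Composition.boundaries, mem_map]
  constructor
  · rintro ⟨k, -, rfl⟩
    exact ⟨k, rfl⟩
  · rintro ⟨k, hk⟩
    -- Taking more blocks than there are changes nothing, so `k` may be truncated.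
    refine ⟨⟨min k c.length, by omega⟩, mem_univ _, Fin.ext ?_⟩
    change c.sizeUpTo (min k c.length) = p
    rw [← hk, Composition.sizeUpTo, ← Composition.blocks_length]
    rcases le_total k c.blocks.length with h | h
    · rw [min_eq_left h]
    · rw [min_eq_right h, List.take_length, List.take_of_length_le h]

lemma zero_mem_boundaries (c : Composition n) : 0 ∈ c.boundaries :=
  (mem_boundaries_iff c 0).2 ⟨0, by simp⟩

lemma last_mem_boundaries (c : Composition n) : Fin.last n ∈ c.boundaries :=
  (mem_boundaries_iff c _).2 ⟨c.blocks.length, by simp⟩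

lemma boundaries_injective : Function.Injective (Composition.boundaries (n := n)) :=
  fun _ _ h => (compositionEquiv n).injective (CompositionAsSet.ext h)

lemma boundaries_compositionOfCuts (s : Finset (Fin (n + 1))) :
    (compositionOfCuts s).boundaries = insert 0 (insert (Fin.last n) s) := by
  rw [compositionOfCuts, CompositionAsSet.toComposition_boundaries]

lemma blocks_compositionOfCuts (s : Finset (Fin (n + 1))) {β : List Bool} (hn : β.length = n)
    (hβ : β.getLast? ≠ some false) (h : ∀ i : Fin n, i.succ ∈ s ↔ β[(i : ℕ)]? = some true) :
    (compositionOfCuts s).blocks = parts β := by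
  let c : Composition n := ⟨parts β, parts_pos β _, (sum_parts hβ).trans hn⟩
  suffices hc : compositionOfCuts s = c by rw [hc]
  apply boundaries_injective
  ext p
  rw [boundaries_compositionOfCuts, mem_insert, mem_insert]
  refine ⟨?_, fun hp => ?_⟩
  · rintro (rfl | rfl | hp)
    · exact zero_mem_boundaries c
    · exact last_mem_boundaries c
    · induction p using Fin.cases with
      | zero => exact zero_mem_boundaries c
      | succ i =>
        rw [mem_boundaries_iff, Fin.val_succ]
        exact (exists_sum_take_parts_iff hβ _).2 ((h i).1 hp)
  · induction p using Fin.cases with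
    | zero => exact Or.inl rfl
    | succ i =>
      rw [mem_boundaries_iff, Fin.val_succ] at hp
      exact Or.inr (Or.inr ((h i).2 ((exists_sum_take_parts_iff hβ _).1 hp)))

lemma blocks_wordComp (u : Fin n → ℕ) : (wordComp u).blocks = parts (lastBits u) := by
  refine blocks_compositionOfCuts _ (by simp [lastBits]) (getLast?_lastBits_ne u) fun i => ?_
  simp [lastBits]

lemma boundaries_descentComp_subset_iff (u : Fin n → ℕ) (J : Composition n) :
    (descentComp u).boundaries ⊆ J.boundaries ↔ AllowsDescents (bits J.blocks) u := by
  have hJ : ∀ i : ℕ, (bits J.blocks)[i]? = some true ↔ ∃ k, (J.blocks.take k).sum = i + 1 := by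
    intro i
    rw [← exists_sum_take_parts_iff (getLast?_bits_ne _), parts_bits fun m hm => J.blocks_pos hm]
  rw [descentComp, boundaries_compositionOfCuts]
  constructor
  · intro h i hi hlt
    have := @h (Fin.succ ⟨i, by omega⟩) (by
      rw [mem_insert, mem_insert, mem_filter]
      exact Or.inr (Or.inr ⟨mem_univ _, ⟨i, by omega⟩, ⟨i + 1, hi⟩, rfl, rfl, hlt⟩))
    rw [mem_boundaries_iff] at this
    exact (hJ i).2 this
  · intro h p hp
    rw [mem_insert, mem_insert, mem_filter] at hp
    obtain rfl | rfl | ⟨-, i, j, rfl, hj, hlt⟩ := hp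
    · exact zero_mem_boundaries J
    · exact last_mem_boundaries J
    · have hj' : (j : ℕ) = i + 1 := congrArg Fin.val hj
      rw [mem_boundaries_iff, Fin.val_succ]
      refine (hJ i).1 (h i (hj' ▸ j.2) ?_)
      convert hlt using 2
      exact Fin.ext hj'.symm

/-- Taking complements in the cuts of `I` turns this into the alternating sum over all subsets of
`I.boundaries \ D.boundaries`, which vanishes unless that set is empty. -/
lemma sum_neg_one_pow_interval (D I : Composition n) :
    ∑ J : Composition n with J.boundaries ⊆ I.boundaries ∧ D.boundaries ⊆ J.boundaries,
      (-1 : ℤ) ^ (I.length - J.length) = if D = I then 1 else 0 := by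
  by_cases hDI : D.boundaries ⊆ I.boundaries
  · have hiff : D = I ↔ I.boundaries \ D.boundaries = ∅ := by
      rw [sdiff_eq_empty_iff_subset]
      exact ⟨fun h => h ▸ subset_rfl, fun h => boundaries_injective (hDI.antisymm h)⟩
    simp only [hiff]
    rw [← sum_powerset_neg_one_pow_card]
    have hb : ∀ T ⊆ I.boundaries \ D.boundaries,
        (compositionOfCuts (I.boundaries \ T)).boundaries = I.boundaries \ T := by
      intro T hT
      rw [boundaries_compositionOfCuts, insert_eq_of_mem, insert_eq_of_mem]
      · exact mem_sdiff.2 ⟨last_mem_boundaries I,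
          fun h => (mem_sdiff.1 (hT h)).2 (last_mem_boundaries D)⟩
      · exact mem_insert_of_mem (mem_sdiff.2 ⟨zero_mem_boundaries I,
          fun h => (mem_sdiff.1 (hT h)).2 (zero_mem_boundaries D)⟩)
    refine sum_nbij' (fun J => I.boundaries \ J.boundaries)
      (fun T => compositionOfCuts (I.boundaries \ T)) ?_ ?_ ?_ ?_ ?_
    · intro J hJ
      rw [mem_filter] at hJ
      exact mem_powerset.2 (sdiff_subset_sdiff subset_rfl hJ.2.2)
    · intro T hT
      rw [mem_powerset] at hT
      rw [mem_filter, hb T hT]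
      refine ⟨mem_univ _, sdiff_subset, fun p hp => mem_sdiff.2 ⟨hDI hp, fun h => ?_⟩⟩
      exact (mem_sdiff.1 (hT h)).2 hp
    · intro J hJ
      rw [mem_filter] at hJ
      apply boundaries_injective
      rw [hb _ (sdiff_subset_sdiff subset_rfl hJ.2.2), Finset.sdiff_sdiff_eq_self hJ.2.1]
    · intro T hT
      rw [mem_powerset] at hT
      rw [hb T hT, Finset.sdiff_sdiff_eq_self (hT.trans sdiff_subset)]
    · intro J hJ
      rw [mem_filter] at hJ
      rw [card_sdiff_of_subset hJ.2.1, Composition.card_boundaries_eq_succ_length,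
        Composition.card_boundaries_eq_succ_length, Nat.add_sub_add_right]
  · have hne : D ≠ I := by
      rintro rfl
      exact hDI subset_rfl
    rw [if_neg hne, filter_false_of_mem, sum_empty]
    exact fun J _ h => hDI (h.2.trans h.1)

end Compositions

/-! ### Ribbon expansion and uniqueness of coefficients. -/

section Main

variable (K : Type*) [Field K] {n : ℕ}

theorem Sprod_eq_sum_Psi [CharZero K] (J : Composition n) :
    Sprod K J = ∑ u ∈ packedWords n with (descentComp u).boundaries ⊆ J.boundaries,
      Psi K (wordComp u) := by
  have h := descentSum_bits K fun m (hm : m ∈ J.blocks) => J.blocks_pos hm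
  rw [J.blocks_sum, descentSum] at h
  rw [Sprod, ← h]
  classical
  refine sum_congr (filter_congr fun u _ => (boundaries_descentComp_subset_iff u J).symm)
    fun u _ => ?_
  rw [Psi_eq, blocks_wordComp, monomialOfBits]

/-- After exchanging sums, each word `u` carries the alternating sum over the compositions between
`D(u)` and `I`. -/
theorem ribbon_eq_sum_Psi [CharZero K] (I : Composition n) :
    ribbon K I = ∑ u ∈ packedWords n with descentComp u = I, Psi K (wordComp u) := by
  have h1 : ∀ J : Composition n, (-1) ^ (I.length - J.length) * Sprod K J =
      ∑ u ∈ packedWords n, if (descentComp u).boundaries ⊆ J.boundaries then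
        (-1) ^ (I.length - J.length) * Psi K (wordComp u) else 0 := by
    intro J
    rw [Sprod_eq_sum_Psi, mul_sum, sum_filter]
  rw [ribbon, sum_congr rfl fun J _ => h1 J, sum_comm, sum_filter]
  refine sum_congr rfl fun u _ => ?_
  have h := congrArg (Int.cast (R := Sym K)) (sum_neg_one_pow_interval (descentComp u) I)
  push_cast at h
  rw [← sum_filter, filter_filter, ← sum_mul, h, ite_mul, one_mul, zero_mul]

lemma packedCount_eq_card (I J : Composition n) : packedCount I J =
    #{u ∈ packedWords n | descentComp u = I ∧ wordComp u = J} := by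
  rw [packedCount, ← Set.ncard_coe_finset]
  congr 1
  ext u
  simp

theorem ribbon_eq_sum_packedCount [CharZero K] (I : Composition n) :
    ribbon K I = ∑ J : Composition n, (packedCount I J : K) • Psi K J := by
  rw [ribbon_eq_sum_Psi, ← sum_fiberwise _ wordComp]
  refine sum_congr rfl fun J _ => ?_
  rw [packedCount_eq_card, filter_filter, Nat.cast_smul_eq_nsmul, ← sum_const]
  refine sum_congr rfl fun u hu => ?_
  rw [(mem_filter.1 hu).2.2]

/-- The `S^J` are distinct words in the free generators, hence part of the monomial basis. -/
lemma linearIndependent_Sprod : LinearIndependent K (Sprod K : Composition n → Sym K) := by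
  let w : Composition n → FreeMonoid ℕ+ := fun J => FreeMonoid.ofList (J.blocks.map Nat.toPNat')
  have hw : Function.Injective w := by
    intro J J' h
    have h := congrArg (List.map PNat.val) (FreeMonoid.ofList.injective h)
    have hid : ∀ c : Composition n, (c.blocks.map Nat.toPNat').map PNat.val = c.blocks := by
      intro c
      rw [List.map_map]
      refine (List.map_congr_left fun m hm => ?_).trans (List.map_id _)
      exact Nat.succ_pred_eq_of_pos (c.blocks_pos hm)
    rw [hid, hid] at h
    exact Composition.ext h
  have hS : (Sprod K : Composition n → Sym K) = FreeAlgebra.basisFreeMonoid K ℕ+ ∘ w := by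
    funext J
    have : ∀ m ∈ J.blocks, S K m = FreeAlgebra.ι K (Nat.toPNat' m) := by
      intro m hm
      have h0 := J.blocks_pos hm
      rw [S, dif_pos h0]
      congr 1
      exact PNat.eq (Nat.succ_pred_eq_of_pos h0).symm
    rw [Sprod, List.map_congr_left this]
    simp [FreeAlgebra.basisFreeMonoid, w, FreeAlgebra.equivMonoidAlgebraFreeMonoid,
      FreeMonoid.lift_apply, Function.comp_def]
  rw [hS]
  exact (FreeAlgebra.basisFreeMonoid K ℕ+).linearIndependent.comp w hw

/-- A dimension count: the span of the `Ψ_J` contains the independent `S^J`, indexed by the same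
finite set. No triangularity of the transition matrix is required. -/
theorem linearIndependent_Psi [CharZero K] :
    LinearIndependent K (Psi K : Composition n → Sym K) := by
  rw [linearIndependent_iff_card_le_finrank_span,
    linearIndependent_iff_card_eq_finrank_span.1 (linearIndependent_Sprod K (n := n))]
  have : FiniteDimensional K (Submodule.span K (Set.range (Psi K : Composition n → Sym K))) :=
    FiniteDimensional.span_of_finite K (Set.finite_range _)
  refine Submodule.finrank_mono (Submodule.span_le.2 ?_)
  rintro _ ⟨J, rfl⟩
  rw [Sprod_eq_sum_Psi]
  exact Submodule.sum_mem _ fun u _ => Submodule.subset_span ⟨_, rfl⟩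

end Main

end NCSF

end

theorem mainTheorem2 (K : Type*) [Field K] [CharZero K] (n : ℕ) (I : Composition n) :
    NCSF.ribbon K I = ∑ J : Composition n, (NCSF.packedCount I J : K) • NCSF.Psi K J ∧
      ∀ c : Composition n → K, NCSF.ribbon K I = ∑ J : Composition n, c J • NCSF.Psi K J →
        ∀ J : Composition n, c J = (NCSF.packedCount I J : K) := by
  refine ⟨NCSF.ribbon_eq_sum_packedCount K I, fun c hc J => ?_⟩
  have h := hc.symm.trans (NCSF.ribbon_eq_sum_packedCount K I)
  rw [← sub_eq_zero, ← Finset.sum_sub_distrib] at h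
  simp only [← sub_smul] at h
  exact sub_eq_zero.1 (Fintype.linearIndependent_iff.1 (NCSF.linearIndependent_Psi K) _ h J)
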